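/- Write $\mathbb D=\{z\in\mathbb C:|z|<1\}$ and ${}_2F_1(a,b;c;z)=\sum_{n\ge0}\frac{(a)_n(b)_n}{(c)_n\,n!}z^n$ for $z\in\mathbb D$, where $(x)_0=1$ and $(x)_n=x(x+1)\cdots(x+n-1)$. "Univalent" means analytic and injective. For functions $g,h$ on $\mathbb D$, $g\prec h$ means that $g=h\circ\omega$ on $\mathbb D$ for some analytic $\omega$ on $\mathbb D$ with $|\omega(z)|\le|z|$. For $\varphi$ analytic on $\mathbb D$ with $\varphi(0)=1$, let $\mathcal S^*(\varphi)$ be the set of analytic $f$ on $\mathbb D$ with $f(0)=0$, $f'(0)=1$, $f(z)\ne0$ for $0<|z|<1$, and $zf'/f\prec\varphi$ (where $zf'/f$ takes the value $1$ at $z=0$). Let $\mathcal Q$ be the set of all analytic functions $Q$ for which there exist finitely many points $\zeta_1,\dots,\zeta_n\in\partial\mathbb D$ such that: 1. $Q$ is analytic and univalent on a neighbourhood of $\overline{\mathbb D}\setminus\{\zeta_1,\dots,\zeta_n\}$; 2. $Q(0)=0$; 3. for each $j$, $Q(z)$ has a limit $w_j\in\mathbb C\cup\{\infty\}$ as $z\to\zeta_j$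 in $\mathbb D$; 4. if $w_j\in\mathbb C$, then for some real $\beta_j>1$ a branch of $(Q(z)-w_j)^{\beta_j}$, defined for $z\in\mathbb D$ near $\zeta_j$, extends to a univalent function on a neighbourhood of $\zeta_j$; 5. if $w_j=\infty$, then for some real $\beta_j\ge1$ a branch of $Q(z)^{-\beta_j}$, defined for $z\in\mathbb D$ near $\zeta_j$, extends to a univalent function on a neighbourhood of $\zeta_j$; 6. if $w_j=\infty$ and $\beta_j=1$, then the (extended) function $P=1/Q$ satisfies $\zeta_jP'(\zeta_j)\in\mathbb C\setminus[0,1]$. **Theorem.** Let $a,b,c\in\mathbb C$ with $c\ne0,-1,-2,\dots$, and let $\varphi=1+Q$ for some $Q\in\mathcal Q$, with exceptional points $\zeta_1,\dots,\zeta_n$ as above. Put $p=a+b+1-c$, $A=Q\,(Q+c-1)$ and $B=(Q+a)(Q+b)$. If $$0<-2\,\mathrm{Re}\big[(pQ(\zeta)+ab)\,\overline{\zeta Q'(\zeta)}\big] \quad\text{and}\quad |B(\zeta)|^2-|A(\zeta)|^2\le-2\,\mathrm{Re}\big[(pQ(\zeta)+ab)\,\overline{\zeta Q'(\zeta)}\big]$$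 for all $\zeta\in\partial\mathbb D\setminus\{\zeta_1,\dots,\zeta_n\}$, then the function $f(z)=z\,{}_2F_1(a,b;c;z)$ belongs to $\mathcal S^*(\varphi)$. -/

import Mathlib

open scoped ComplexConjugate

namespace ShiftedGauss

/-- The open unit disk. -/
abbrev unitDisk : Set ℂ := Metric.ball 0 1

/-- `f` is analytic and univalent (injective) on the set `U`; used for open `U`. -/
def UnivalentOn (f : ℂ → ℂ) (U : Set ℂ) : Prop :=
  AnalyticOnNhd ℂ f U ∧ Set.InjOn f U

/-- `L` is a continuous branch of `log h` on the set `S`; in particular `h` has no zero on `S`. -/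
def IsLogBranchOn (L h : ℂ → ℂ) (S : Set ℂ) : Prop :=
  ContinuousOn L S ∧ ∀ z ∈ S, Complex.exp (L z) = h z

/-- At the boundary point `ζ`, `Q` has a finite limit `w` from inside the disk, and for some
`β > 1` a branch of `(Q - w) ^ β` extends to a univalent function `g` near `ζ`. -/
def HasFiniteCorner (Q : ℂ → ℂ) (ζ : ℂ) : Prop :=
  ∃ w : ℂ, Filter.Tendsto Q (nhdsWithin ζ unitDisk) (nhds w) ∧
    ∃ β : ℝ, 1 < β ∧ ∃ (U : Set ℂ) (g L : ℂ → ℂ), IsOpen U ∧ ζ ∈ U ∧ UnivalentOn g U ∧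
      IsLogBranchOn L (fun z => Q z - w) (U ∩ unitDisk) ∧
      ∀ z ∈ U ∩ unitDisk, g z = Complex.exp ((β : ℂ) * L z)

/-- At the boundary point `ζ`, `Q` tends to `∞` from inside the disk, and for some `β ≥ 1`
a branch of `Q ^ (-β)` extends to a univalent function `g` near `ζ`. If `β = 1`, then `g` is
the extension of `1 / Q`, and `ζ * g' ζ` is required not to lie in the segment `[0, 1]`. -/
def HasInfiniteCorner (Q : ℂ → ℂ) (ζ : ℂ) : Prop :=
  Filter.Tendsto Q (nhdsWithin ζ unitDisk) (Bornology.cobounded ℂ) ∧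
    ∃ β : ℝ, 1 ≤ β ∧ ∃ (U : Set ℂ) (g L : ℂ → ℂ), IsOpen U ∧ ζ ∈ U ∧ UnivalentOn g U ∧
      IsLogBranchOn L Q (U ∩ unitDisk) ∧
      (∀ z ∈ U ∩ unitDisk, g z = Complex.exp (-(β : ℂ) * L z)) ∧
      (β = 1 → ∀ t : ℝ, 0 ≤ t → t ≤ 1 → ζ * deriv g ζ ≠ (t : ℂ))

/-- `Q` belongs to the admissible class, with `E` as its finite set of exceptional points on the
unit circle. -/
structure IsAdmissible (Q : ℂ → ℂ) (E : Finset ℂ) : Prop where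
  exceptional_mem : ∀ ζ ∈ E, ‖ζ‖ = 1
  univalent : ∃ U : Set ℂ, IsOpen U ∧ Metric.closedBall 0 1 \ (E : Set ℂ) ⊆ U ∧ UnivalentOn Q U
  map_zero : Q 0 = 0
  corner : ∀ ζ ∈ E, HasFiniteCorner Q ζ ∨ HasInfiniteCorner Q ζ

/-- Subordination `g ≺ h` on the unit disk. -/
def Subordinate (g h : ℂ → ℂ) : Prop :=
  ∃ ω : ℂ → ℂ, AnalyticOnNhd ℂ ω unitDisk ∧ (∀ z ∈ unitDisk, ‖ω z‖ ≤ ‖z‖) ∧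
    ∀ z ∈ unitDisk, g z = h (ω z)

/-- The class of analytic functions `f` on the disk with `f 0 = 0` and `f' 0 = 1`. -/
def classA1 : Set (ℂ → ℂ) :=
  {f | AnalyticOnNhd ℂ f unitDisk ∧ f 0 = 0 ∧ deriv f 0 = 1}

/-- The class `S*(φ)` of those `f` in `classA1` with `z f' / f ≺ φ`. The quotient has to be
finite, that is, `f` has no zero other than the origin, where the quotient takes its limit `1`. -/
def starClass (φ : ℂ → ℂ) : Set (ℂ → ℂ) :=
  {f | f ∈ classA1 ∧ (∀ z ∈ unitDisk, z ≠ 0 → f z ≠ 0) ∧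
    Subordinate (Function.update (fun z => z * deriv f z / f z) 0 1) φ}

end ShiftedGauss

/-!
Let `F` be the hypergeometric function, `θ = z d/dz` and `q = θF / F`. Then `z f' / f = 1 + q`, so
`q` has to be shown to be subordinate to `Q`; the hypergeometric equation becomes the Riccati
equation `θq + q (q + c - 1) = z (θq + (q + a) (q + b))`.

As long as `q` maps `|z| < r` into the image of `Q`, one has `q = Q ∘ ω` there with
`|ω z| ≤ |z| / r`. If `q` is about to leave that image at `z₀`, then `ω z` accumulates at some `ζ`
with `|ζ| = 1` as `z` tends to `z₀` along the radius. At an unexceptional `ζ`, Jack's lemma gives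
`θq z₀ = m θQ ζ` with `m ≥ 1`, and the Riccati equation at `z₀` contradicts the two inequalities
at `ζ`. A finite corner, or an infinite one with `β > 1`, would make `ω` approach the unit circle
faster than linearly, which the bound `|ω z| ≤ |z| / r` rules out. At an infinite corner with
`β = 1`, `z₀` is a zero of `F`, of multiplicity `n` say, and Jack's lemma for `1 / q` and
`P = 1 / Q` gives `ζ P'(ζ) = 1 / (n m)`, a point of `[0, 1]`.
-/

namespace ShiftedGauss

open Filter Topology Metric

section EulerDeriv

variable {𝕜 : Type*} [NontriviallyNormedField 𝕜]

/-- The Euler operator `z d/dz`. It multiplies the `n`-th Taylor coefficient at the origin by `n`,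
so that it turns a recurrence for the coefficients into a differential equation. -/
noncomputable def eulerDeriv (F : 𝕜 → 𝕜) (z : 𝕜) : 𝕜 := z * deriv F z

theorem analyticAt_eulerDeriv [CompleteSpace 𝕜] {F : 𝕜 → 𝕜} {z : 𝕜} (hF : AnalyticAt 𝕜 F z) :
    AnalyticAt 𝕜 (eulerDeriv F) z :=
  analyticAt_id.mul hF.deriv

theorem derivSeries_unshift_ofScalars (u : ℕ → 𝕜) :
    (FormalMultilinearSeries.ofScalars 𝕜 u).derivSeries.unshift 0 =
      FormalMultilinearSeries.ofScalars 𝕜 fun n => n * u n := by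
  refine FormalMultilinearSeries.ext fun n => ContinuousMultilinearMap.ext_ring ?_
  cases n with
  | zero => simp [FormalMultilinearSeries.unshift, FormalMultilinearSeries.ofScalars]
  | succ n =>
    have h := FormalMultilinearSeries.derivSeries_coeff_one
      (FormalMultilinearSeries.ofScalars 𝕜 u) n
    rw [FormalMultilinearSeries.coeff_ofScalars, nsmul_eq_mul] at h
    exact h.trans (FormalMultilinearSeries.coeff_ofScalars (p := fun n => n * u n)).symm

theorem hasFPowerSeriesOnBall_eulerDeriv [CompleteSpace 𝕜] {F : 𝕜 → 𝕜} {u : ℕ → 𝕜} {R : ENNReal}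
    (h : HasFPowerSeriesOnBall F (FormalMultilinearSeries.ofScalars 𝕜 u) 0 R) :
    HasFPowerSeriesOnBall (eulerDeriv F)
      (FormalMultilinearSeries.ofScalars 𝕜 fun n => n * u n) 0 R := by
  have h' := h.fderiv.unshift (z := 0)
  rw [derivSeries_unshift_ofScalars] at h'
  refine h'.congr fun z _ => ?_
  simp [eulerDeriv, fderiv_eq_smul_deriv]

end EulerDeriv

section Hypergeometric

theorem ordinaryHypergeometricCoefficient_succ {K : Type*} [Field K] [CharZero K] {c : K}
    (hc : ∀ n : ℕ, c ≠ -(n : K)) (a b : K) (n : ℕ) :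
    ((n : K) + 1) * (n + c) * ordinaryHypergeometricCoefficient a b c (n + 1) =
      (n + a) * (n + b) * ordinaryHypergeometricCoefficient a b c n := by
  have hpoch : (ascPochhammer K n).eval c ≠ 0 := by
    rw [Ne, ascPochhammer_eval_eq_zero_iff]
    rintro ⟨k, -, hk⟩
    exact hc k (by rw [hk, neg_neg])
  have hcn : c + n ≠ 0 := fun h => hc n (eq_neg_of_add_eq_zero_left h)
  have hn : (n : K) + 1 ≠ 0 := Nat.cast_add_one_ne_zero n
  have hfact : (n.factorial : K) ≠ 0 := Nat.cast_ne_zero.2 n.factorial_ne_zero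
  simp only [ordinaryHypergeometricCoefficient, ascPochhammer_succ_eval, Nat.factorial_succ]
  push_cast
  field_simp
  ring

variable {𝕜 : Type*} [RCLike 𝕜] {a b c : 𝕜}

theorem one_le_radius_ordinaryHypergeometricSeries (hc : ∀ n : ℕ, c ≠ -(n : 𝕜)) :
    1 ≤ (ordinaryHypergeometricSeries 𝕜 a b c).radius := by
  by_cases ha : ∃ k : ℕ, a = -(k : 𝕜)
  · obtain ⟨k, rfl⟩ := ha
    simp [ordinaryHypergeometric_radius_top_of_neg_nat₁]
  by_cases hb : ∃ k : ℕ, b = -(k : 𝕜)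
  · obtain ⟨k, rfl⟩ := hb
    simp [ordinaryHypergeometric_radius_top_of_neg_nat₂]
  push Not at ha hb
  refine (ordinaryHypergeometricSeries_radius_eq_one (𝔸 := 𝕜) _ _ _ fun n => ?_).ge
  exact ⟨fun h => ha n (by rw [h, neg_neg]), fun h => hb n (by rw [h, neg_neg]),
    fun h => hc n (by rw [h, neg_neg])⟩

theorem hasFPowerSeriesOnBall_ordinaryHypergeometric (hc : ∀ n : ℕ, c ≠ -(n : 𝕜)) :
    HasFPowerSeriesOnBall (ordinaryHypergeometric a b c : 𝕜 → 𝕜)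
      (ordinaryHypergeometricSeries 𝕜 a b c) 0 1 :=
  ((ordinaryHypergeometricSeries 𝕜 a b c).hasFPowerSeriesOnBall
    (one_pos.trans_le (one_le_radius_ordinaryHypergeometricSeries hc))).mono one_pos
    (one_le_radius_ordinaryHypergeometricSeries hc)

theorem analyticOnNhd_ordinaryHypergeometric (hc : ∀ n : ℕ, c ≠ -(n : 𝕜)) :
    AnalyticOnNhd 𝕜 (ordinaryHypergeometric a b c : 𝕜 → 𝕜) (ball 0 1) := by
  have h := (hasFPowerSeriesOnBall_ordinaryHypergeometric (a := a) (b := b) hc).analyticOnNhd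
  rwa [← ENNReal.ofReal_one, eball_ofReal] at h

/-- The coefficients of the two sides agree by the recurrence `(n + 1) (n + c) u (n + 1) =
(n + a) (n + b) u n`, once the left-hand side has been shifted by one. -/
theorem ordinaryHypergeometric_ode (hc : ∀ n : ℕ, c ≠ -(n : 𝕜)) {z : 𝕜} (hz : ‖z‖ < 1) :
    eulerDeriv (eulerDeriv (ordinaryHypergeometric a b c)) z +
        (c - 1) * eulerDeriv (ordinaryHypergeometric a b c) z =
      z * (eulerDeriv (eulerDeriv (ordinaryHypergeometric a b c)) z +
        (a + b) * eulerDeriv (ordinaryHypergeometric a b c) z +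
        a * b * ordinaryHypergeometric a b c z) := by
  have hsum {u : ℕ → 𝕜} {G : 𝕜 → 𝕜}
      (hG : HasFPowerSeriesOnBall G (FormalMultilinearSeries.ofScalars 𝕜 u) 0 1) :
      HasSum (fun n => u n * z ^ n) (G z) := by
    simpa [FormalMultilinearSeries.ofScalars_apply_eq, mul_comm] using
      hG.hasSum (y := z) (by rwa [← ENNReal.ofReal_one, eball_ofReal, mem_ball_zero_iff])
  have h₀ := hasFPowerSeriesOnBall_ordinaryHypergeometric (a := a) (b := b) hc
  have h₁ := hasFPowerSeriesOnBall_eulerDeriv h₀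
  have h₂ := hasFPowerSeriesOnBall_eulerDeriv h₁
  have hl := (hasSum_nat_add_iff' 1).2 ((hsum h₂).add ((hsum h₁).mul_left (c - 1)))
  have hr := (((hsum h₂).add ((hsum h₁).mul_left (a + b))).add
    ((hsum h₀).mul_left (a * b))).mul_left z
  simp only [Finset.sum_range_one, Nat.cast_zero, zero_mul, mul_zero, add_zero, sub_zero] at hl
  refine hl.unique (hr.congr_fun fun n => ?_)
  push_cast
  linear_combination z ^ (n + 1) * ordinaryHypergeometricCoefficient_succ hc a b n

end Hypergeometric

section EulerLogDeriv

variable {𝕜 : Type*}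

/-- The quotient `z F' / F`, the logarithmic derivative of `F` for the Euler operator. At a zero
of `F` it has the junk value `0`, and so has its inverse, which is then the correct value of
`F / (z F')`. -/
noncomputable def eulerLogDeriv [NontriviallyNormedField 𝕜] (F : 𝕜 → 𝕜) (z : 𝕜) : 𝕜 :=
  eulerDeriv F z / F z

section NontriviallyNormedField

variable [NontriviallyNormedField 𝕜] {F h : 𝕜 → 𝕜} {z z₀ : 𝕜}

theorem eulerLogDeriv_zero (F : 𝕜 → 𝕜) : eulerLogDeriv F 0 = 0 := by
  simp [eulerLogDeriv, eulerDeriv]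

theorem analyticOrderNatAt_ne_zero (hF : AnalyticAt 𝕜 F z₀) (hFz₀ : F z₀ = 0)
    (hne : ¬ ∀ᶠ z in 𝓝 z₀, F z = 0) : analyticOrderNatAt F z₀ ≠ 0 := by
  simp [analyticOrderNatAt, ENat.toNat_eq_zero, hF.analyticOrderAt_eq_zero, hFz₀,
    analyticOrderAt_eq_top, hne]

variable [CompleteSpace 𝕜]

theorem analyticAt_eulerLogDeriv (hF : AnalyticAt 𝕜 F z) (hFz : F z ≠ 0) :
    AnalyticAt 𝕜 (eulerLogDeriv F) z :=
  (analyticAt_eulerDeriv hF).div hF hFz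

theorem eulerDeriv_eulerLogDeriv (hF : AnalyticAt 𝕜 F z) (hFz : F z ≠ 0) :
    eulerDeriv (eulerLogDeriv F) z =
      eulerDeriv (eulerDeriv F) z / F z - eulerLogDeriv F z ^ 2 := by
  have h : deriv (eulerLogDeriv F) z = _ :=
    deriv_fun_div (analyticAt_eulerDeriv hF).differentiableAt hF.differentiableAt hFz
  simp only [eulerDeriv, eulerLogDeriv] at h ⊢
  rw [h]
  field_simp

theorem inv_eulerLogDeriv_eventuallyEq {n : ℕ} (hn : n ≠ 0) (hh : AnalyticAt 𝕜 h z₀)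
    (hF : F =ᶠ[𝓝 z₀] fun z => (z - z₀) ^ n * h z) :
    (eulerLogDeriv F)⁻¹ =ᶠ[𝓝 z₀]
      fun z => (z - z₀) * (h z / (z * (n * h z + (z - z₀) * deriv h z))) := by
  obtain ⟨k, rfl⟩ := Nat.exists_eq_add_one_of_ne_zero hn
  filter_upwards [hF.eventuallyEq_nhds, hh.eventually_analyticAt] with z hFz hhz
  have hder : HasDerivAt F
      ((k + 1 : ℕ) * (z - z₀) ^ k * h z + (z - z₀) ^ (k + 1) * deriv h z) z := by
    simpa using ((((hasDerivAt_id z).sub_const z₀).fun_pow (k + 1)).fun_mul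
      hhz.differentiableAt.hasDerivAt).congr_of_eventuallyEq hFz
  rw [Pi.inv_apply, eulerLogDeriv, eulerDeriv, hder.deriv, inv_div, hFz.self_of_nhds]
  rcases eq_or_ne z z₀ with rfl | hz
  · simp
  · have hz' : z - z₀ ≠ 0 := sub_ne_zero.2 hz
    rw [mul_div_assoc', ← mul_div_mul_left ((z - z₀) * h z) _ (pow_ne_zero k hz')]
    congr 1 <;> ring

theorem analyticAt_inv_eulerLogDeriv [CharZero 𝕜] (hF : AnalyticAt 𝕜 F z₀) (hz₀ : z₀ ≠ 0)
    (hFz₀ : F z₀ = 0) (hne : ¬ ∀ᶠ z in 𝓝 z₀, F z = 0) :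
    AnalyticAt 𝕜 (eulerLogDeriv F)⁻¹ z₀ ∧
      eulerDeriv (eulerLogDeriv F)⁻¹ z₀ = (analyticOrderNatAt F z₀ : 𝕜)⁻¹ := by
  obtain ⟨h, hh, hhz₀, hFh⟩ :=
    hF.analyticOrderAt_ne_top.1 (by rwa [Ne, analyticOrderAt_eq_top])
  have hn := analyticOrderNatAt_ne_zero hF hFz₀ hne
  have heq := inv_eulerLogDeriv_eventuallyEq hn hh hFh
  have hquot : AnalyticAt 𝕜 (fun z => h z /
      (z * (analyticOrderNatAt F z₀ * h z + (z - z₀) * deriv h z))) z₀ := by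
    have := hh.deriv
    exact hh.fun_div (by fun_prop) (by simp [hz₀, hhz₀, hn])
  have hder := ((hasDerivAt_id' z₀).sub_const z₀).fun_mul hquot.differentiableAt.hasDerivAt
  refine ⟨AnalyticAt.congr (by fun_prop) heq.symm, ?_⟩
  rw [eulerDeriv, heq.deriv_eq, hder.deriv]
  simp only [sub_self, zero_mul, add_zero, one_mul]
  field_simp

theorem tendsto_eulerLogDeriv_cobounded [CharZero 𝕜] (hF : AnalyticAt 𝕜 F z₀) (hz₀ : z₀ ≠ 0)
    (hFz₀ : F z₀ = 0) (hne : ¬ ∀ᶠ z in 𝓝 z₀, F z = 0) :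
    Tendsto (eulerLogDeriv F) (𝓝[≠] z₀) (Bornology.cobounded 𝕜) := by
  obtain ⟨hinv, hder⟩ := analyticAt_inv_eulerLogDeriv hF hz₀ hFz₀ hne
  have hder₀ : deriv (eulerLogDeriv F)⁻¹ z₀ ≠ 0 := by
    refine right_ne_zero_of_mul (a := z₀) (ne_of_eq_of_ne hder (inv_ne_zero ?_))
    exact Nat.cast_ne_zero.2 (analyticOrderNatAt_ne_zero hF hFz₀ hne)
  have h := hinv.differentiableAt.hasDerivAt.tendsto_nhdsNE hder₀
  rw [Pi.inv_apply, eulerLogDeriv, hFz₀, div_zero, inv_zero] at h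
  simpa [Function.comp_def] using tendsto_inv₀_nhdsNE_zero.comp h

end NontriviallyNormedField

theorem eulerLogDeriv_ordinaryHypergeometric_riccati [RCLike 𝕜] {a b c z : 𝕜}
    (hc : ∀ n : ℕ, c ≠ -(n : 𝕜)) (hz : ‖z‖ < 1) (hFz : ordinaryHypergeometric a b c z ≠ 0) :
    eulerDeriv (eulerLogDeriv (ordinaryHypergeometric a b c)) z +
        eulerLogDeriv (ordinaryHypergeometric a b c) z *
          (eulerLogDeriv (ordinaryHypergeometric a b c) z + c - 1) =
      z * (eulerDeriv (eulerLogDeriv (ordinaryHypergeometric a b c)) z +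
        (eulerLogDeriv (ordinaryHypergeometric a b c) z + a) *
          (eulerLogDeriv (ordinaryHypergeometric a b c) z + b)) := by
  have hode := ordinaryHypergeometric_ode (a := a) (b := b) hc hz
  rw [eulerDeriv_eulerLogDeriv
    (analyticOnNhd_ordinaryHypergeometric hc z (mem_ball_zero_iff.2 hz)) hFz, eulerLogDeriv]
  field_simp
  linear_combination ordinaryHypergeometric a b c z * hode

end EulerLogDeriv

section Univalent

variable {g h : ℂ → ℂ} {ζ : ℂ} {U : Set ℂ}

theorem exists_analyticAt_localInverse (hg : AnalyticAt ℂ g ζ) (hg' : deriv g ζ ≠ 0) :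
    ∃ G : ℂ → ℂ, AnalyticAt ℂ G (g ζ) ∧ (∀ᶠ z in 𝓝 ζ, G (g z) = z) ∧
      ∀ᶠ w in 𝓝 (g ζ), g (G w) = w :=
  ⟨_, hg.analyticAt_localInverse hg', hg.hasStrictDerivAt.eventually_left_inverse hg',
    hg.hasStrictDerivAt.eventually_right_inverse hg'⟩

theorem exists_analyticAt_pow_eq {n : ℕ} (hn : n ≠ 0) (hh : AnalyticAt ℂ h ζ) (hζ : h ζ ≠ 0) :
    ∃ k : ℂ → ℂ, AnalyticAt ℂ k ζ ∧ ∀ᶠ z in 𝓝 ζ, k z ^ n = h z := by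
  obtain ⟨κ, hκ⟩ := IsAlgClosed.exists_pow_nat_eq (h ζ) (Nat.pos_of_ne_zero hn)
  have hκ₀ : κ ≠ 0 := fun h₀ => hζ (by rw [← hκ, h₀, zero_pow hn])
  have hpow : AnalyticAt ℂ (fun w : ℂ => w ^ n) κ := by fun_prop
  have hder : deriv (fun w : ℂ => w ^ n) κ ≠ 0 := by simp [hn, hκ₀]
  obtain ⟨G, hG, -, hpowG⟩ := exists_analyticAt_localInverse hpow hder
  rw [hκ] at hG hpowG
  exact ⟨G ∘ h, hG.comp hh, hh.continuousAt.eventually hpowG⟩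

theorem exists_sub_eq_pow (hg : AnalyticAt ℂ g ζ) (hne : ¬ ∀ᶠ z in 𝓝 ζ, g z = g ζ) :
    ∃ (n : ℕ) (φ : ℂ → ℂ), n ≠ 0 ∧ AnalyticAt ℂ φ ζ ∧ φ ζ = 0 ∧ deriv φ ζ ≠ 0 ∧
      ∀ᶠ z in 𝓝 ζ, g z = g ζ + φ z ^ n := by
  have hsub : AnalyticAt ℂ (fun z => g z - g ζ) ζ := hg.fun_sub analyticAt_const
  have hne' : ¬ ∀ᶠ z in 𝓝 ζ, g z - g ζ = 0 := by simpa only [sub_eq_zero] using hne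
  obtain ⟨h, hh, hhζ, hgh⟩ :=
    hsub.analyticOrderAt_ne_top.1 (by rwa [Ne, analyticOrderAt_eq_top])
  have hn := analyticOrderNatAt_ne_zero hsub (sub_self _) hne'
  obtain ⟨k, hk, hkh⟩ := exists_analyticAt_pow_eq hn hh hhζ
  have hder := ((hasDerivAt_id' ζ).sub_const ζ).fun_mul hk.differentiableAt.hasDerivAt
  refine ⟨_, fun z => (z - ζ) * k z, hn, by fun_prop, by simp, ?_, ?_⟩
  · rw [hder.deriv, sub_self, zero_mul, add_zero, one_mul]
    exact pow_ne_zero_iff hn |>.1 (hkh.self_of_nhds.trans_ne hhζ)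
  · filter_upwards [hgh, hkh] with z hgz hkz
    rw [mul_pow, hkz, ← smul_eq_mul, ← hgz, add_sub_cancel]

theorem not_eventually_eq_of_injOn {X Y : Type*} [TopologicalSpace X] {f : X → Y} {x : X}
    [(𝓝[≠] x).NeBot] {s : Set X} (hs : s ∈ 𝓝 x) (hf : Set.InjOn f s) :
    ¬ ∀ᶠ y in 𝓝 x, f y = f x := by
  intro hconst
  have hx : ∀ᶠ y in 𝓝[≠] x, y = x := nhdsWithin_le_nhds <| by
    filter_upwards [hconst, hs] with y hy hys
    exact hf hys (mem_of_mem_nhds hs) hy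
  obtain ⟨y, hy, hy'⟩ := (hx.and self_mem_nhdsWithin).exists
  exact hy' hy

/-- Near `ζ` one has `g = g ζ + φ ^ n` with `φ` locally invertible, so `g` identifies the points
where `φ` takes the values `w` and `ε w`, for `ε` a primitive `n`-th root of unity. -/
theorem deriv_ne_zero_of_injOn (hg : AnalyticAt ℂ g ζ) (hU : U ∈ 𝓝 ζ) (hinj : Set.InjOn g U) :
    deriv g ζ ≠ 0 := by
  obtain ⟨n, φ, hn, hφ, hφζ, hφ', hgφ⟩ :=
    exists_sub_eq_pow hg (not_eventually_eq_of_injOn hU hinj)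
  have hprim := Complex.isPrimitiveRoot_exp n hn
  set ε := Complex.exp (2 * Real.pi * Complex.I / n)
  have himage : φ '' (U ∩ {z | g z = g ζ + φ z ^ n}) ∈ 𝓝 0 := by
    rw [← hφζ, ← hφ.hasStrictDerivAt.map_nhds_eq hφ']
    exact image_mem_map (inter_mem hU hgφ)
  have hrot : Tendsto (fun z => ε * φ z) (𝓝 ζ) (𝓝 0) := by
    simpa [hφζ] using hφ.continuousAt.tendsto.const_mul ε
  have hφ_ne : ∀ᶠ z in 𝓝[≠] ζ, φ z ≠ 0 := hφ.differentiableAt.hasDerivAt.eventually_ne hφ'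
  have hrot_mem : ∀ᶠ z in 𝓝 ζ, ε * φ z ∈ φ '' (U ∩ {z | g z = g ζ + φ z ^ n}) :=
    hrot.eventually_mem himage
  obtain ⟨z, hφz, ⟨z', ⟨hz'U, hgz'⟩, hφz'⟩, hzU, hgz⟩ := (hφ_ne.and <|
    nhdsWithin_le_nhds <| hrot_mem.and <| (eventually_mem_set.2 hU).and hgφ).exists
  have heq : z' = z := by
    refine hinj hz'U hzU ?_
    rw [hgz', hgz, hφz', mul_pow, hprim.pow_eq_one, one_mul]
  have hε : ε = 1 := by
    rw [heq] at hφz'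
    exact mul_right_cancel₀ hφz (hφz'.symm.trans (one_mul _).symm)
  obtain rfl : n = 1 := hprim.unique (hε ▸ IsPrimitiveRoot.one)
  simpa [EventuallyEq.deriv_eq hgφ] using hφ'

theorem UnivalentOn.deriv_ne_zero (hg : UnivalentOn g U) (hU : IsOpen U) (hζ : ζ ∈ U) :
    deriv g ζ ≠ 0 :=
  deriv_ne_zero_of_injOn (hg.1 ζ hζ) (hU.mem_nhds hζ) hg.2

theorem UnivalentOn.isOpen_image (hg : UnivalentOn g U) (hU : IsOpen U) : IsOpen (g '' U) := by
  rw [isOpen_iff_mem_nhds]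
  rintro _ ⟨z, hz, rfl⟩
  rw [← (hg.1 z hz).hasStrictDerivAt.map_nhds_eq (hg.deriv_ne_zero hU hz)]
  exact image_mem_map (hU.mem_nhds hz)

theorem UnivalentOn.analyticOnNhd_invFunOn (hg : UnivalentOn g U) (hU : IsOpen U) :
    AnalyticOnNhd ℂ (Function.invFunOn g U) (g '' U) := by
  rintro _ ⟨z, hz, rfl⟩
  obtain ⟨G, hG, hleft, hright⟩ :=
    exists_analyticAt_localInverse (hg.1 z hz) (hg.deriv_ne_zero hU hz)
  have hGU : U ∈ 𝓝 (G (g z)) := by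
    rw [hleft.self_of_nhds]
    exact hU.mem_nhds hz
  refine hG.congr ?_
  filter_upwards [hright, hG.continuousAt.eventually_mem hGU] with w hw hwU
  exact hg.2 hwU (Function.invFunOn_mem ⟨_, hwU, hw⟩)
    (hw.trans (Function.invFunOn_eq ⟨_, hwU, hw⟩).symm)

end Univalent

section JackLemma

variable {ω : ℂ → ℂ} {z₀ : ℂ}

theorem im_eq_zero_and_re_nonneg_of_forall_re_mul_nonpos {N : ℂ}
    (hN : ∀ v : ℂ, v.re < 0 → (N * v).re ≤ 0) : N.im = 0 ∧ 0 ≤ N.re := by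
  constructor
  · by_contra him
    have h := hN (-1 - ((N.re + 1) / N.im : ℝ) * Complex.I) (by simp)
    have hcancel : N.im * ((N.re + 1) / N.im) = N.re + 1 := mul_div_cancel₀ _ him
    simp only [Complex.mul_re, Complex.sub_re, Complex.neg_re, Complex.one_re, Complex.sub_im,
      Complex.neg_im, Complex.one_im, Complex.ofReal_re, Complex.ofReal_im, Complex.mul_im,
      Complex.I_re, Complex.I_im] at h
    linarith
  · simpa using hN (-1) (by simp)

theorem tendsto_mul_exp_nhdsWithin_ball (hz₀ : z₀ ≠ 0) {v : ℂ} (hv : v.re < 0) :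
    Tendsto (fun t : ℝ => z₀ * Complex.exp (t * v)) (𝓝[>] 0) (𝓝[ball 0 ‖z₀‖] z₀) := by
  refine tendsto_nhdsWithin_iff.2 ⟨?_, ?_⟩
  · have hcont : Continuous fun t : ℝ => z₀ * Complex.exp (t * v) := by fun_prop
    simpa using (hcont.tendsto 0).mono_left nhdsWithin_le_nhds
  · filter_upwards [self_mem_nhdsWithin] with t (ht : 0 < t)
    rw [mem_ball_zero_iff, norm_mul, Complex.norm_exp, Complex.re_ofReal_mul]
    exact mul_lt_of_lt_one_right (norm_pos_iff.2 hz₀)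
      (Real.exp_lt_one_iff.2 (mul_neg_of_pos_of_neg ht hv))

/-- The difference `exp (t Re v) - Re (ω (z₀ exp (t v)) / ω z₀)` vanishes at `t = 0` and is
nonnegative for small `t > 0`, so its derivative at `t = 0` is nonnegative. -/
theorem re_mul_le_re_of_norm_div_le (hz₀ : z₀ ≠ 0) (hω : DifferentiableAt ℂ ω z₀)
    (hωz₀ : ω z₀ ≠ 0)
    (hle : ∀ᶠ z in 𝓝[ball 0 ‖z₀‖] z₀, ‖ω z‖ / ‖ω z₀‖ ≤ ‖z‖ / ‖z₀‖) {v : ℂ} (hv : v.re < 0) :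
    (z₀ * deriv ω z₀ / ω z₀ * v).re ≤ v.re := by
  have hpath : HasDerivAt (fun t : ℝ => z₀ * Complex.exp (t * v)) (z₀ * v) 0 := by
    simpa using ((((hasDerivAt_id (0 : ℝ)).ofReal_comp).mul_const v).cexp).const_mul z₀
  have hre : HasDerivAt (fun t : ℝ => (ω (z₀ * Complex.exp (t * v)) / ω z₀).re)
      (z₀ * deriv ω z₀ / ω z₀ * v).re 0 := by
    have h := (hω.hasDerivAt.comp_of_eq (0 : ℝ) hpath (by simp)).div_const (ω z₀)
    rw [show deriv ω z₀ * (z₀ * v) / ω z₀ = z₀ * deriv ω z₀ / ω z₀ * v by ring] at h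
    exact Complex.reCLM.hasFDerivAt.comp_hasDerivAt (0 : ℝ) h
  have hexp : HasDerivAt (fun t : ℝ => Real.exp (t * v.re)) v.re 0 := by
    simpa using ((hasDerivAt_id (0 : ℝ)).mul_const v.re).exp
  rw [← sub_nonneg]
  refine ge_of_tendsto (hexp.fun_sub hre).tendsto_slope_zero_right ?_
  filter_upwards [(tendsto_mul_exp_nhdsWithin_ball hz₀ hv).eventually hle,
    self_mem_nhdsWithin] with t hle_t (ht : 0 < t)
  rw [norm_mul, mul_div_cancel_left₀ _ (norm_ne_zero_iff.2 hz₀), Complex.norm_exp,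
    Complex.re_ofReal_mul, ← norm_div] at hle_t
  have hdiff := sub_nonneg.2 ((Complex.re_le_norm _).trans hle_t)
  simpa [hωz₀] using mul_nonneg (inv_nonneg.2 ht.le) hdiff

theorem exists_one_le_eulerDeriv_eq_mul (hz₀ : z₀ ≠ 0) (hω : DifferentiableAt ℂ ω z₀)
    (hωz₀ : ω z₀ ≠ 0)
    (hle : ∀ᶠ z in 𝓝[ball 0 ‖z₀‖] z₀, ‖ω z‖ / ‖ω z₀‖ ≤ ‖z‖ / ‖z₀‖) :
    ∃ m : ℝ, 1 ≤ m ∧ eulerDeriv ω z₀ = m * ω z₀ := by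
  obtain ⟨him, hre⟩ := im_eq_zero_and_re_nonneg_of_forall_re_mul_nonpos
    (N := z₀ * deriv ω z₀ / ω z₀ - 1) fun v hv => by
      rw [sub_mul, one_mul, Complex.sub_re, sub_nonpos]
      exact re_mul_le_re_of_norm_div_le hz₀ hω hωz₀ hle hv
  rw [Complex.sub_im, Complex.one_im, sub_zero] at him
  rw [Complex.sub_re, Complex.one_re, sub_nonneg] at hre
  refine ⟨_, hre, ?_⟩
  rw [← Complex.ext (z := z₀ * deriv ω z₀ / ω z₀) (Complex.ofReal_re _).symm
    (by rw [him, Complex.ofReal_im]), div_mul_cancel₀ _ hωz₀, eulerDeriv]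

end JackLemma

section SchwarzFunctions

/-- The Schwarz functions on the disk of radius `r`: analytic functions of modulus at most
`‖z‖ / r`. They are the functions occurring in a subordination, rescaled to that disk. -/
structure IsSchwarzOn (ω : ℂ → ℂ) (r : ℝ) : Prop where
  analyticOnNhd : AnalyticOnNhd ℂ ω (ball 0 r)
  norm_le : ∀ z ∈ ball (0 : ℂ) r, ‖ω z‖ ≤ ‖z‖ / r

variable {ω g s Q q : ℂ → ℂ} {z₀ ζ : ℂ} {r : ℝ} {l : Filter ℂ} {D V : Set ℂ}

theorem IsSchwarzOn.mapsTo (hω : IsSchwarzOn ω r) : Set.MapsTo ω (ball 0 r) unitDisk := by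
  intro z hz
  rw [mem_ball_zero_iff]
  exact (hω.norm_le z hz).trans_lt
    ((div_lt_one (pos_of_mem_ball hz)).2 (mem_ball_zero_iff.1 hz))

theorem exists_isSchwarzOn_comp_eqOn (hQ : UnivalentOn Q unitDisk)
    (hq : AnalyticOnNhd ℂ q (ball 0 r)) (hq₀ : q 0 = Q 0)
    (hmaps : Set.MapsTo q (ball 0 r) (Q '' unitDisk)) :
    ∃ ω, IsSchwarzOn ω r ∧ Set.EqOn (Q ∘ ω) q (ball 0 r) := by
  have hω : AnalyticOnNhd ℂ (Function.invFunOn Q unitDisk ∘ q) (ball 0 r) :=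
    (hQ.analyticOnNhd_invFunOn isOpen_ball).comp hq hmaps
  have hω_maps : Set.MapsTo (Function.invFunOn Q unitDisk ∘ q) (ball 0 r) unitDisk :=
    fun z hz => Function.invFunOn_mem (hmaps hz)
  have hω₀ : (Function.invFunOn Q unitDisk ∘ q) 0 = 0 := by
    rw [Function.comp_apply, hq₀]
    exact hQ.2.leftInvOn_invFunOn (mem_ball_self one_pos)
  refine ⟨_, ⟨hω, fun z hz => ?_⟩, fun z hz => Function.invFunOn_eq (hmaps hz)⟩
  have h := Complex.dist_le_div_mul_dist_of_mapsTo_ball hω.differentiableOn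
    (by rw [hω₀]; exact hω_maps.mono_right ball_subset_closedBall) hz
  rwa [hω₀, dist_zero_right, dist_zero_right, one_div_mul_eq_div] at h

/-- The function `ω₁` is `s` followed by a local inverse of `g`; it agrees with `ω` near the points
where `ω` is close to `ζ`, and then everywhere near `z₀` by the identity theorem. -/
theorem exists_analyticAt_extension (hDo : IsOpen D) (hDc : Convex ℝ D)
    (hω : AnalyticOnNhd ℂ ω D) (hg : AnalyticAt ℂ g ζ) (hg' : deriv g ζ ≠ 0)
    (hs : AnalyticAt ℂ s z₀) [l.NeBot] (hl : l ≤ 𝓝[D] z₀) (hlim : Tendsto ω l (𝓝 ζ))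
    (hV : V ∈ 𝓝 ζ) (hsg : ∀ᶠ z in 𝓝[D] z₀, ω z ∈ V → s z = g (ω z)) :
    ∃ ω₁ : ℂ → ℂ, AnalyticAt ℂ ω₁ z₀ ∧ ω₁ z₀ = ζ ∧ ω₁ =ᶠ[𝓝[D] z₀] ω ∧ s =ᶠ[𝓝 z₀] g ∘ ω₁ := by
  have hsz₀ : s z₀ = g ζ := by
    refine tendsto_nhds_unique (hs.continuousAt.mono_left (hl.trans nhdsWithin_le_nhds))
      ((hg.continuousAt.tendsto.comp hlim).congr' ?_)
    filter_upwards [hl hsg, hlim.eventually_mem hV] with z hz hzV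
    exact (hz hzV).symm
  obtain ⟨G, hG, hleft, hright⟩ := exists_analyticAt_localInverse hg hg'
  rw [← hsz₀] at hG hright
  have hω₁ : AnalyticAt ℂ (G ∘ s) z₀ := hG.comp hs
  refine ⟨G ∘ s, hω₁, ?_, ?_, (hs.continuousAt.eventually hright).mono fun z hz => hz.symm⟩
  · rw [Function.comp_apply, hsz₀, hleft.self_of_nhds]
  obtain ⟨δ, hδ, hball⟩ := Metric.eventually_nhds_iff_ball.1
    (hω₁.eventually_analyticAt.and (eventually_nhdsWithin_iff.1 hsg))
  have hconn : IsPreconnected (ball z₀ δ ∩ D) := ((convex_ball z₀ δ).inter hDc).isPreconnected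
  obtain ⟨O, hO, hOo, hζO⟩ := _root_.mem_nhds_iff.1 (inter_mem hV hleft)
  have hz_mem : ∀ᶠ z in l, z ∈ ball z₀ δ ∩ D :=
    hl (inter_mem (mem_nhdsWithin_of_mem_nhds (ball_mem_nhds z₀ hδ)) self_mem_nhdsWithin)
  obtain ⟨z₁, hz₁, hz₁O⟩ := (hz_mem.and (hlim.eventually_mem (hOo.mem_nhds hζO))).exists
  have heq : Set.EqOn (G ∘ s) ω (ball z₀ δ ∩ D) := by
    refine AnalyticOnNhd.eqOn_of_preconnected_of_eventuallyEq (fun z hz => (hball z hz.1).1)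
      (hω.mono Set.inter_subset_right) hconn hz₁ ?_
    filter_upwards [(hω z₁ hz₁.2).continuousAt.eventually_mem (hOo.mem_nhds hz₁O),
      (isOpen_ball.inter hDo).mem_nhds hz₁] with z hzO hz
    rw [Function.comp_apply, (hball z hz.1).2 hz.2 (hO hzO).1]
    exact (hO hzO).2
  exact heq.eventuallyEq_of_mem
    (inter_mem (mem_nhdsWithin_of_mem_nhds (ball_mem_nhds z₀ hδ)) self_mem_nhdsWithin)

/-- Jack's lemma applied to the extension of `ω` past `z₀`. -/
theorem IsSchwarzOn.exists_one_le_eulerDeriv_eq (hω : IsSchwarzOn ω ‖z₀‖) (hz₀ : z₀ ≠ 0)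
    (hζ : ‖ζ‖ = 1) (hg : AnalyticAt ℂ g ζ) (hg' : deriv g ζ ≠ 0) (hs : AnalyticAt ℂ s z₀)
    [l.NeBot] (hl : l ≤ 𝓝[ball 0 ‖z₀‖] z₀) (hlim : Tendsto ω l (𝓝 ζ)) (hV : V ∈ 𝓝 ζ)
    (hsg : ∀ᶠ z in 𝓝[ball 0 ‖z₀‖] z₀, ω z ∈ V → s z = g (ω z)) :
    ∃ m : ℝ, 1 ≤ m ∧ eulerDeriv s z₀ = m * eulerDeriv g ζ := by
  obtain ⟨ω₁, hω₁, hω₁z₀, hω₁ω, hsω₁⟩ := exists_analyticAt_extension isOpen_ball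
    (convex_ball 0 _) hω.analyticOnNhd hg hg' hs hl hlim hV hsg
  have hω₁_le : ∀ᶠ z in 𝓝[ball 0 ‖z₀‖] z₀, ‖ω₁ z‖ / ‖ω₁ z₀‖ ≤ ‖z‖ / ‖z₀‖ := by
    filter_upwards [hω₁ω, self_mem_nhdsWithin] with z hz hz_mem
    rw [hω₁z₀, hζ, div_one, hz]
    exact hω.norm_le z hz_mem
  obtain ⟨m, hm, hmω⟩ := exists_one_le_eulerDeriv_eq_mul hz₀ hω₁.differentiableAt
    (by rw [hω₁z₀, ← norm_ne_zero_iff, hζ]; exact one_ne_zero) hω₁_le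
  refine ⟨m, hm, ?_⟩
  have hchain : deriv s z₀ = deriv g ζ * deriv ω₁ z₀ := by
    rw [hsω₁.deriv_eq, deriv_comp z₀ (by rw [hω₁z₀]; exact hg.differentiableAt)
      hω₁.differentiableAt, hω₁z₀]
  simp only [eulerDeriv, hω₁z₀] at hmω ⊢
  linear_combination z₀ * hchain + deriv g ζ * hmω

end SchwarzFunctions

section RadialApproach

variable {ω g s Q q : ℂ → ℂ} {z₀ ζ : ℂ} {l : Filter ℂ} {β t : ℝ}

theorem openSegment_zero_subset_ball (hz₀ : z₀ ≠ 0) : openSegment ℝ 0 z₀ ⊆ ball 0 ‖z₀‖ :=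
  openSegment_subset_ball_of_ne (mem_closedBall_self (norm_nonneg _))
    (mem_closedBall_zero_iff.2 le_rfl) hz₀.symm

theorem nhdsWithin_openSegment_zero_le (hz₀ : z₀ ≠ 0) :
    𝓝[openSegment ℝ 0 z₀] z₀ ≤ 𝓝[ball 0 ‖z₀‖] z₀ :=
  nhdsWithin_mono _ (openSegment_zero_subset_ball hz₀)

theorem norm_sub_eq_of_mem_openSegment_zero {E : Type*} [SeminormedAddCommGroup E]
    [NormedSpace ℝ E] {x y : E} (hx : x ∈ openSegment ℝ 0 y) : ‖x - y‖ = ‖y‖ - ‖x‖ := by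
  have h := dist_add_dist_of_mem_segment (openSegment_subset_segment ℝ 0 y hx)
  rw [dist_zero_left, dist_zero_left, dist_eq_norm] at h
  exact eq_sub_of_add_eq' h

theorem IsSchwarzOn.exists_ultrafilter_tendsto (hω : IsSchwarzOn ω ‖z₀‖) (hz₀ : z₀ ≠ 0) :
    ∃ (l : Ultrafilter ℂ) (ζ : ℂ),
      ↑l ≤ 𝓝[openSegment ℝ 0 z₀] z₀ ∧ ζ ∈ closedBall 0 1 ∧ Tendsto ω l (𝓝 ζ) := by
  have : (𝓝[openSegment ℝ 0 z₀] z₀).NeBot := by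
    rw [← mem_closure_iff_nhdsWithin_neBot, closure_openSegment]
    exact right_mem_segment ℝ 0 z₀
  obtain ⟨l, hl⟩ := Ultrafilter.exists_le (𝓝[openSegment ℝ 0 z₀] z₀)
  have hmem : ∀ᶠ z in l, ω z ∈ closedBall 0 1 := by
    filter_upwards [hl self_mem_nhdsWithin] with z hz
    exact ball_subset_closedBall (hω.mapsTo (openSegment_zero_subset_ball hz₀ hz))
  obtain ⟨ζ, hζ, hlim⟩ := (isCompact_closedBall (0 : ℂ) 1).ultrafilter_le_nhds' (l.map ω) hmem
  exact ⟨l, ζ, hl, hζ, hlim⟩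

theorem IsSchwarzOn.isBigO_sub (hω : IsSchwarzOn ω ‖z₀‖) (hz₀ : z₀ ≠ 0) (hζ : ‖ζ‖ = 1)
    (hl : l ≤ 𝓝[openSegment ℝ 0 z₀] z₀) :
    (fun z => z - z₀) =O[l] fun z => ω z - ζ := by
  refine Asymptotics.IsBigO.of_bound ‖z₀‖ ?_
  filter_upwards [hl self_mem_nhdsWithin] with z hz
  have hz₀_pos : 0 < ‖z₀‖ := norm_pos_iff.2 hz₀
  have hle := (le_div_iff₀ hz₀_pos).1 (hω.norm_le z (openSegment_zero_subset_ball hz₀ hz))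
  rw [norm_sub_eq_of_mem_openSegment_zero hz]
  calc ‖z₀‖ - ‖z‖ ≤ ‖z₀‖ * (‖ζ‖ - ‖ω z‖) := by rw [hζ]; linarith
    _ ≤ ‖z₀‖ * ‖ω z - ζ‖ := by
      rw [norm_sub_rev]
      gcongr
      exact norm_sub_norm_le ζ (ω z)

theorem isLittleO_norm_rpow {α E F : Type*} [NormedAddCommGroup E] [NormedAddCommGroup F]
    {l : Filter α} {u : α → E} {v : α → F} (huv : u =O[l] v) (hv : Tendsto v l (𝓝 0))
    (hβ : 1 < β) : (fun x => ‖u x‖ ^ β) =o[l] v := by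
  have hrpow : Tendsto (fun x => ‖u x‖ ^ (β - 1)) l (𝓝 0) := by
    have h := (huv.trans_tendsto hv).norm.rpow_const (p := β - 1) (Or.inr (by linarith))
    rwa [norm_zero, Real.zero_rpow (by linarith)] at h
  have h := ((Asymptotics.isLittleO_one_iff ℝ).2 hrpow).mul_isBigO huv.norm_norm
  simp only [one_mul] at h
  refine (h.congr_left fun x => ?_).of_norm_right
  rw [← Real.rpow_add_one' (norm_nonneg _) (by linarith), sub_add_cancel]

/-- Along the radius, `z - z₀ = O(ω z - ζ)`. If `g'(ζ)` were nonzero, this would be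
`O(g (ω z))`, which is `o(z - z₀)` since `β > 1`. -/
theorem IsSchwarzOn.deriv_eq_zero_of_norm_comp_eq_rpow (hω : IsSchwarzOn ω ‖z₀‖) (hz₀ : z₀ ≠ 0)
    (hζ : ‖ζ‖ = 1) (hg : DifferentiableAt ℂ g ζ) (hs : DifferentiableAt ℂ s z₀) [l.NeBot]
    (hl : l ≤ 𝓝[openSegment ℝ 0 z₀] z₀) (hlim : Tendsto ω l (𝓝 ζ)) (hβ : 1 < β)
    (hsg : ∀ᶠ z in l, ‖g (ω z)‖ = ‖s z - s z₀‖ ^ β) : deriv g ζ = 0 := by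
  by_contra hg'
  have hlz₀ : l ≤ 𝓝 z₀ := hl.trans nhdsWithin_le_nhds
  have hsub : Tendsto (fun z => z - z₀) l (𝓝 0) := tendsto_sub_nhds_zero_iff.2 hlz₀
  have hsmall : (fun z => g (ω z)) =o[l] fun z => z - z₀ :=
    ((isLittleO_norm_rpow (hs.isBigO_sub.mono hlz₀) hsub hβ).congr'
      (hsg.mono fun z hz => hz.symm) .rfl).of_norm_left
  have hgζ : g ζ = 0 :=
    tendsto_nhds_unique (hg.continuousAt.tendsto.comp hlim) (hsmall.isBigO.trans_tendsto hsub)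
  have hpair : Tendsto (fun z => (ω z, ζ)) l (𝓝 ζ ×ˢ pure ζ) :=
    hlim.prodMk (tendsto_pure.2 (.of_forall fun _ => rfl))
  have hlarge : (fun z => ω z - ζ) =O[l] fun z => g (ω z) := by
    simpa only [Function.comp_def, hgζ, sub_zero] using
      (hg.hasDerivAt.isTheta_sub hg').2.comp_tendsto hpair
  refine Asymptotics.isLittleO_irrefl (Eventually.frequently ?_)
    (((hω.isBigO_sub hz₀ hζ hl).trans hlarge).trans_isLittleO hsmall)
  filter_upwards [hl self_mem_nhdsWithin] with z hz
  have hz_lt := mem_ball_zero_iff.1 (openSegment_zero_subset_ball hz₀ hz)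
  exact sub_ne_zero.2 fun h => hz_lt.ne (congrArg norm h)

theorem IsSchwarzOn.tendsto_of_tendsto (hω : IsSchwarzOn ω ‖z₀‖)
    (hQω : Set.EqOn (Q ∘ ω) q (ball 0 ‖z₀‖)) (hl : l ≤ 𝓝[ball 0 ‖z₀‖] z₀)
    (hlim : Tendsto ω l (𝓝 ζ)) {f : Filter ℂ} (hf : Tendsto Q (𝓝[unitDisk] ζ) f) :
    Tendsto q l f := by
  have hmem : ∀ᶠ z in l, z ∈ ball 0 ‖z₀‖ := hl self_mem_nhdsWithin
  refine (hf.comp <| tendsto_nhdsWithin_iff.2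
    ⟨hlim, hmem.mono fun z hz => hω.mapsTo hz⟩).congr' ?_
  filter_upwards [hmem] with z hz using hQω hz

theorem norm_cexp_ofReal_mul (β : ℝ) (w : ℂ) :
    ‖Complex.exp (β * w)‖ = ‖Complex.exp w‖ ^ β := by
  rw [Complex.norm_exp, Complex.norm_exp, Complex.re_ofReal_mul, mul_comm, Real.exp_mul]

theorem IsSchwarzOn.not_hasFiniteCorner (hω : IsSchwarzOn ω ‖z₀‖) (hz₀ : z₀ ≠ 0) (hζ : ‖ζ‖ = 1)
    (hQω : Set.EqOn (Q ∘ ω) q (ball 0 ‖z₀‖)) (hq : DifferentiableAt ℂ q z₀) [l.NeBot]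
    (hl : l ≤ 𝓝[openSegment ℝ 0 z₀] z₀) (hlim : Tendsto ω l (𝓝 ζ)) : ¬ HasFiniteCorner Q ζ := by
  rintro ⟨w, hw, β, hβ, U, g, L, hUo, hζU, hg, hL, hgL⟩
  have hlball : l ≤ 𝓝[ball 0 ‖z₀‖] z₀ := hl.trans (nhdsWithin_openSegment_zero_le hz₀)
  have hqw : q z₀ = w :=
    tendsto_nhds_unique (hq.continuousAt.tendsto.mono_left (hl.trans nhdsWithin_le_nhds))
      (hω.tendsto_of_tendsto hQω hlball hlim hw)
  refine hg.deriv_ne_zero hUo hζU (hω.deriv_eq_zero_of_norm_comp_eq_rpow hz₀ hζ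
    (hg.1 ζ hζU).differentiableAt hq hl hlim hβ ?_)
  filter_upwards [hlball self_mem_nhdsWithin, hlim.eventually_mem (hUo.mem_nhds hζU)] with z hz hzU
  have hz' : ω z ∈ U ∩ unitDisk := ⟨hzU, hω.mapsTo hz⟩
  rw [hgL _ hz', norm_cexp_ofReal_mul, hL.2 _ hz', hqw, ← hQω hz, Function.comp_apply]

theorem IsSchwarzOn.not_hasInfiniteCorner (hω : IsSchwarzOn ω ‖z₀‖) (hz₀ : z₀ ≠ 0)
    (hζ : ‖ζ‖ = 1) (hQω : Set.EqOn (Q ∘ ω) q (ball 0 ‖z₀‖)) (hq : AnalyticAt ℂ q⁻¹ z₀)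
    (hqz₀ : q⁻¹ z₀ = 0) (ht₀ : 0 ≤ t) (ht₁ : t ≤ 1) (hqt : eulerDeriv q⁻¹ z₀ = t) [l.NeBot]
    (hl : l ≤ 𝓝[openSegment ℝ 0 z₀] z₀) (hlim : Tendsto ω l (𝓝 ζ)) :
    ¬ HasInfiniteCorner Q ζ := by
  rintro ⟨-, β, hβ, U, g, L, hUo, hζU, hg, hL, hgL, hβ₁⟩
  have hg' : deriv g ζ ≠ 0 := hg.deriv_ne_zero hUo hζU
  have hlball : l ≤ 𝓝[ball 0 ‖z₀‖] z₀ :=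
    hl.trans (nhdsWithin_openSegment_zero_le hz₀)
  have hgω : ∀ z ∈ ball 0 ‖z₀‖, ω z ∈ U →
      g (ω z) = Complex.exp (β * -L (ω z)) ∧ Complex.exp (-L (ω z)) = q⁻¹ z := by
    intro z hz hzU
    have hz' : ω z ∈ U ∩ unitDisk := ⟨hzU, hω.mapsTo hz⟩
    rw [hgL _ hz', neg_mul_comm, Complex.exp_neg, hL.2 _ hz', Pi.inv_apply, ← hQω hz]
    exact ⟨rfl, rfl⟩
  rcases hβ.eq_or_lt with rfl | hβ
  · obtain ⟨m, hm, hmg⟩ := hω.exists_one_le_eulerDeriv_eq hz₀ hζ (hg.1 ζ hζU) hg' hq hlball hlim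
      (hUo.mem_nhds hζU) <| by
        filter_upwards [self_mem_nhdsWithin] with z hz hzU
        obtain ⟨hgz, hqz⟩ := hgω z hz hzU
        rw [hgz, Complex.ofReal_one, one_mul, hqz]
    have hm₀ : 0 < m := one_pos.trans_le hm
    refine hβ₁ rfl (t / m) (by positivity) ((div_le_one hm₀).2 (ht₁.trans hm)) ?_
    rw [Complex.ofReal_div, eq_div_iff (Complex.ofReal_ne_zero.2 hm₀.ne'), ← hqt, hmg, eulerDeriv,
      mul_comm]
  · refine hg' (hω.deriv_eq_zero_of_norm_comp_eq_rpow hz₀ hζ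
      (hg.1 ζ hζU).differentiableAt hq.differentiableAt hl hlim hβ ?_)
    filter_upwards [hlball self_mem_nhdsWithin, hlim.eventually_mem (hUo.mem_nhds hζU)]
      with z hz hzU
    obtain ⟨hgz, hqz⟩ := hgω z hz hzU
    rw [hgz, norm_cexp_ofReal_mul, hqz, hqz₀, sub_zero]

end RadialApproach

section BoundaryContact

variable {Q q F ω : ℂ → ℂ} {E : Finset ℂ} {z₀ ζ : ℂ} {t : ℝ}

theorem IsAdmissible.univalentOn_unitDisk (hQ : IsAdmissible Q E) : UnivalentOn Q unitDisk := by
  obtain ⟨U, -, hsub, hU⟩ := hQ.univalent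
  have hdisk : unitDisk ⊆ U := fun z hz =>
    hsub ⟨ball_subset_closedBall hz, fun hE =>
      (mem_ball_zero_iff.1 hz).ne (hQ.exceptional_mem z hE)⟩
  exact ⟨hU.1.mono hdisk, hU.2.mono hdisk⟩

theorem IsAdmissible.analyticAt_and_deriv_ne_zero (hQ : IsAdmissible Q E)
    (hζ : ζ ∈ closedBall 0 1) (hE : ζ ∉ E) : AnalyticAt ℂ Q ζ ∧ deriv Q ζ ≠ 0 := by
  obtain ⟨U, hUo, hsub, hU⟩ := hQ.univalent
  exact ⟨hU.1 ζ (hsub ⟨hζ, hE⟩), hU.deriv_ne_zero hUo (hsub ⟨hζ, hE⟩)⟩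

theorem IsAdmissible.exists_tendsto_or_hasInfiniteCorner (hQ : IsAdmissible Q E)
    (hζ : ζ ∈ closedBall 0 1) :
    (∃ w, Tendsto Q (𝓝[unitDisk] ζ) (𝓝 w)) ∨ ‖ζ‖ = 1 ∧ HasInfiniteCorner Q ζ := by
  by_cases hE : ζ ∈ E
  · rcases hQ.corner ζ hE with ⟨w, hw, -⟩ | hinf
    · exact .inl ⟨w, hw⟩
    · exact .inr ⟨hQ.exceptional_mem ζ hE, hinf⟩
  · exact .inl ⟨Q ζ, (hQ.analyticAt_and_deriv_ne_zero hζ hE).1.continuousAt.continuousWithinAt⟩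

theorem IsAdmissible.not_tendsto_cobounded (hQ : IsAdmissible Q E) (hz₀ : z₀ ≠ 0)
    (hq : AnalyticOnNhd ℂ q (ball 0 ‖z₀‖)) (hq₀ : q 0 = 0)
    (hmaps : Set.MapsTo q (ball 0 ‖z₀‖) (Q '' unitDisk)) (hinv : AnalyticAt ℂ q⁻¹ z₀)
    (hinv₀ : q⁻¹ z₀ = 0) (ht₀ : 0 ≤ t) (ht₁ : t ≤ 1) (hqt : eulerDeriv q⁻¹ z₀ = t) :
    ¬ Tendsto q (𝓝[≠] z₀) (Bornology.cobounded ℂ) := by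
  intro hq_infty
  obtain ⟨ω, hω, hQω⟩ := exists_isSchwarzOn_comp_eqOn hQ.univalentOn_unitDisk hq
    (hq₀.trans hQ.map_zero.symm) hmaps
  obtain ⟨l, ζ, hl, hζ, hlim⟩ := hω.exists_ultrafilter_tendsto hz₀
  have hlball : ↑l ≤ 𝓝[ball 0 ‖z₀‖] z₀ := hl.trans (nhdsWithin_openSegment_zero_le hz₀)
  rcases hQ.exists_tendsto_or_hasInfiniteCorner hζ with ⟨w, hw⟩ | ⟨hζ₁, hinf⟩
  · have hl_ne : ↑l ≤ 𝓝[≠] z₀ := hlball.trans <| nhdsWithin_mono _ fun z hz h =>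
      (mem_ball_zero_iff.1 hz).ne (congrArg norm h)
    exact (hω.tendsto_of_tendsto hQω hlball hlim hw).not_tendsto (disjoint_nhds_cobounded w)
      (hq_infty.mono_left hl_ne)
  · exact hω.not_hasInfiniteCorner hz₀ hζ₁ hQω hinv hinv₀ ht₀ ht₁ hqt hl hlim hinf

theorem IsAdmissible.ne_zero_of_mapsTo_ball (hQ : IsAdmissible Q E) (hz₀ : z₀ ≠ 0)
    (hq : AnalyticOnNhd ℂ (eulerLogDeriv F) (ball 0 ‖z₀‖))
    (hmaps : Set.MapsTo (eulerLogDeriv F) (ball 0 ‖z₀‖) (Q '' unitDisk))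
    (hF : AnalyticAt ℂ F z₀) (hne : ¬ ∀ᶠ z in 𝓝 z₀, F z = 0) : F z₀ ≠ 0 := by
  intro hFz₀
  obtain ⟨hinv, hinv'⟩ := analyticAt_inv_eulerLogDeriv hF hz₀ hFz₀ hne
  have hinv₀ : (eulerLogDeriv F)⁻¹ z₀ = 0 := by
    rw [Pi.inv_apply, eulerLogDeriv, hFz₀, div_zero, inv_zero]
  refine hQ.not_tendsto_cobounded hz₀ hq (eulerLogDeriv_zero F) hmaps hinv hinv₀
    (t := (analyticOrderNatAt F z₀ : ℝ)⁻¹) (inv_nonneg.2 (Nat.cast_nonneg _))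
    (Nat.cast_inv_le_one _) ?_ (tendsto_eulerLogDeriv_cobounded hF hz₀ hFz₀ hne)
  rw [hinv', Complex.ofReal_inv, Complex.ofReal_natCast]

theorem IsAdmissible.mem_image_of_mapsTo_ball (hQ : IsAdmissible Q E) (hz₀ : z₀ ≠ 0)
    (hq : AnalyticOnNhd ℂ q (ball 0 ‖z₀‖)) (hq₀ : q 0 = 0)
    (hmaps : Set.MapsTo q (ball 0 ‖z₀‖) (Q '' unitDisk)) (hqz₀ : AnalyticAt ℂ q z₀)
    (hcontact : ∀ ζ : ℂ, ‖ζ‖ = 1 → ζ ∉ E → q z₀ = Q ζ →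
      ∀ m : ℝ, 1 ≤ m → eulerDeriv q z₀ ≠ m * eulerDeriv Q ζ) : q z₀ ∈ Q '' unitDisk := by
  obtain ⟨ω, hω, hQω⟩ := exists_isSchwarzOn_comp_eqOn hQ.univalentOn_unitDisk hq
    (hq₀.trans hQ.map_zero.symm) hmaps
  obtain ⟨l, ζ, hl, hζ, hlim⟩ := hω.exists_ultrafilter_tendsto hz₀
  have hlball : ↑l ≤ 𝓝[ball 0 ‖z₀‖] z₀ := hl.trans (nhdsWithin_openSegment_zero_le hz₀)
  have hq_lim : Tendsto q l (𝓝 (q z₀)) :=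
    hqz₀.continuousAt.mono_left (hl.trans nhdsWithin_le_nhds)
  by_cases hE : ζ ∈ E
  · rcases hQ.corner ζ hE with hfin | hinf
    · exact absurd hfin (hω.not_hasFiniteCorner hz₀ (hQ.exceptional_mem ζ hE) hQω
        hqz₀.differentiableAt hl hlim)
    · exact absurd (hω.tendsto_of_tendsto hQω hlball hlim hinf.1)
        (hq_lim.not_tendsto (disjoint_nhds_cobounded _))
  obtain ⟨hQζ, hQ'ζ⟩ := hQ.analyticAt_and_deriv_ne_zero hζ hE
  have hqζ : q z₀ = Q ζ := tendsto_nhds_unique hq_lim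
    (hω.tendsto_of_tendsto hQω hlball hlim hQζ.continuousAt.continuousWithinAt)
  rcases (mem_closedBall_zero_iff.1 hζ).lt_or_eq with hζ₁ | hζ₁
  · exact ⟨ζ, mem_ball_zero_iff.2 hζ₁, hqζ.symm⟩
  obtain ⟨m, hm, hmQ⟩ := hω.exists_one_le_eulerDeriv_eq hz₀ hζ₁ hQζ hQ'ζ hqz₀ hlball hlim
    univ_mem (eventually_mem_nhdsWithin.mono fun z hz _ => (hQω hz).symm)
  exact absurd hmQ (hcontact ζ hζ₁ hE hqζ m hm)

/-- A point of smallest modulus in the part of the ball outside `G` would lie on the boundary of a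
smaller ball contained in `G`. -/
theorem ball_subset_of_forall_ball_subset {V : Type*} [NormedAddCommGroup V] [ProperSpace V]
    {G : Set V} {R : ℝ} (hG : IsOpen G)
    (hstep : ∀ x ∈ ball (0 : V) R, ball 0 ‖x‖ ⊆ G → x ∈ G) : ball 0 R ⊆ G := by
  by_contra hsub
  obtain ⟨x₁, hx₁, hx₁G⟩ := Set.not_subset.1 hsub
  obtain ⟨x₀, ⟨hx₀, hx₀G⟩, hmin⟩ := ((isCompact_closedBall (0 : V) ‖x₁‖).inter_right
    hG.isClosed_compl).exists_isMinOn ⟨x₁, mem_closedBall_zero_iff.2 le_rfl, hx₁G⟩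
    continuous_norm.continuousOn
  rw [mem_closedBall_zero_iff] at hx₀
  refine hx₀G (hstep x₀ (mem_ball_zero_iff.2 (hx₀.trans_lt (mem_ball_zero_iff.1 hx₁))) ?_)
  intro x hx
  rw [mem_ball_zero_iff] at hx
  by_contra hxG
  exact (hmin ⟨mem_closedBall_zero_iff.2 (hx.le.trans hx₀), hxG⟩).not_gt hx

theorem isOpen_setOf_eulerLogDeriv_mem {𝕜 : Type*} [NontriviallyNormedField 𝕜] [CompleteSpace 𝕜]
    {F : 𝕜 → 𝕜} {U V : Set 𝕜} (hF : AnalyticOnNhd 𝕜 F U) (hU : IsOpen U) (hV : IsOpen V) :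
    IsOpen {z | z ∈ U ∧ F z ≠ 0 ∧ eulerLogDeriv F z ∈ V} := by
  rw [isOpen_iff_mem_nhds]
  rintro z ⟨hz, hFz, hqz⟩
  filter_upwards [hU.mem_nhds hz, (hF z hz).continuousAt.eventually_ne hFz,
    (analyticAt_eulerLogDeriv (hF z hz) hFz).continuousAt.eventually_mem (hV.mem_nhds hqz)]
    with w hw hFw hqw using ⟨hw, hFw, hqw⟩

/-- A Miller–Mocanu type criterion: if `eulerLogDeriv F` left `Q '' unitDisk`, it would do so at a
zero of `F` or at a boundary point satisfying the relation excluded by `hcontact`. -/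
theorem IsAdmissible.ne_zero_and_eulerLogDeriv_mem_image (hQ : IsAdmissible Q E)
    (hF : AnalyticOnNhd ℂ F unitDisk) (hF₀ : F 0 ≠ 0)
    (hcontact : ∀ z ∈ unitDisk, F z ≠ 0 → ∀ ζ : ℂ, ‖ζ‖ = 1 → ζ ∉ E →
      eulerLogDeriv F z = Q ζ → ∀ m : ℝ, 1 ≤ m →
        eulerDeriv (eulerLogDeriv F) z ≠ m * eulerDeriv Q ζ) :
    ∀ z ∈ unitDisk, F z ≠ 0 ∧ eulerLogDeriv F z ∈ Q '' unitDisk := by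
  have hQimage : IsOpen (Q '' unitDisk) := hQ.univalentOn_unitDisk.isOpen_image isOpen_ball
  suffices hsub : unitDisk ⊆ {z | z ∈ unitDisk ∧ F z ≠ 0 ∧ eulerLogDeriv F z ∈ Q '' unitDisk} from
    fun z hz => (hsub hz).2
  refine ball_subset_of_forall_ball_subset
    (isOpen_setOf_eulerLogDeriv_mem hF isOpen_ball hQimage) fun z₀ hz₀ hball => ?_
  obtain rfl | hz₀_ne := eq_or_ne z₀ 0
  · exact ⟨hz₀, hF₀, 0, hz₀, by rw [hQ.map_zero, eulerLogDeriv_zero]⟩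
  have hq : AnalyticOnNhd ℂ (eulerLogDeriv F) (ball 0 ‖z₀‖) := fun z hz =>
    analyticAt_eulerLogDeriv (hF z (hball hz).1) (hball hz).2.1
  have hmaps : Set.MapsTo (eulerLogDeriv F) (ball 0 ‖z₀‖) (Q '' unitDisk) := fun z hz =>
    (hball hz).2.2
  have hne : ¬ ∀ᶠ z in 𝓝 z₀, F z = 0 := fun hzero =>
    hF₀ (hF.eqOn_zero_of_preconnected_of_eventuallyEq_zero
      (convex_ball (0 : ℂ) 1).isPreconnected hz₀ hzero (mem_ball_self one_pos))
  have hF_ne : F z₀ ≠ 0 := hQ.ne_zero_of_mapsTo_ball hz₀_ne hq hmaps (hF z₀ hz₀) hne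
  exact ⟨hz₀, hF_ne, hQ.mem_image_of_mapsTo_ball hz₀_ne hq (eulerLogDeriv_zero F) hmaps
    (analyticAt_eulerLogDeriv (hF z₀ hz₀) hF_ne) (hcontact z₀ hz₀ hF_ne)⟩

end BoundaryContact

section StarClass

variable {F Q : ℂ → ℂ}

theorem deriv_id_mul {𝕜 : Type*} [NontriviallyNormedField 𝕜] {F : 𝕜 → 𝕜} {z : 𝕜}
    (hF : DifferentiableAt 𝕜 F z) : deriv (fun z => z * F z) z = F z + eulerDeriv F z := by
  rw [deriv_fun_mul differentiableAt_fun_id hF, deriv_id'', one_mul, eulerDeriv]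

theorem mul_mem_starClass (hF : AnalyticOnNhd ℂ F unitDisk) (hF₀ : F 0 = 1)
    (hQ : UnivalentOn Q unitDisk) (hQ₀ : Q 0 = 0)
    (hmem : ∀ z ∈ unitDisk, F z ≠ 0 ∧ eulerLogDeriv F z ∈ Q '' unitDisk) :
    (fun z => z * F z) ∈ starClass (fun z => 1 + Q z) := by
  have hderiv : ∀ z ∈ unitDisk, deriv (fun z => z * F z) z = F z + eulerDeriv F z :=
    fun z hz => deriv_id_mul (hF z hz).differentiableAt
  obtain ⟨ω, hω, hQω⟩ := exists_isSchwarzOn_comp_eqOn hQ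
    (fun z hz => analyticAt_eulerLogDeriv (hF z hz) (hmem z hz).1)
    ((eulerLogDeriv_zero F).trans hQ₀.symm) fun z hz => (hmem z hz).2
  refine ⟨⟨fun z hz => analyticAt_id.mul (hF z hz), zero_mul _, ?_⟩,
    fun z hz hz₀ => mul_ne_zero hz₀ (hmem z hz).1,
    ω, hω.analyticOnNhd, fun z hz => by simpa only [div_one] using hω.norm_le z hz, ?_⟩
  · rw [hderiv 0 (mem_ball_self one_pos), hF₀, eulerDeriv, zero_mul, add_zero]
  intro z hz
  have hQωz : Q (ω z) = eulerLogDeriv F z := hQω hz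
  beta_reduce
  rw [hQωz]
  obtain rfl | hz₀ := eq_or_ne z 0
  · rw [Function.update_self, eulerLogDeriv_zero, add_zero]
  · rw [Function.update_of_ne hz₀, hderiv z hz, mul_div_mul_left _ _ hz₀, add_div,
      div_self (hmem z hz).1, eulerLogDeriv]

end StarClass

theorem norm_sq_add_sub_norm_sq_add (A B Y : ℂ) (m : ℝ) :
    ‖m * Y + B‖ ^ 2 - ‖m * Y + A‖ ^ 2 =
      ‖B‖ ^ 2 - ‖A‖ ^ 2 + m * (2 * ((B - A) * conj Y).re) := by
  have hswap : ∀ W : ℂ, (Y * conj W).re = (W * conj Y).re := fun W => by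
    rw [← Complex.conj_re, map_mul, Complex.conj_conj, mul_comm]
  simp only [← Complex.normSq_eq_norm_sq, Complex.normSq_add, mul_assoc, Complex.re_ofReal_mul,
    hswap, sub_mul, Complex.sub_re]
  ring

theorem mul_add_ne_mul_of_boundary_inequality {A B Y z : ℂ} {m : ℝ} (hm : 1 ≤ m) (hz : ‖z‖ < 1)
    (h₁ : 0 < -2 * ((B - A) * conj Y).re)
    (h₂ : ‖B‖ ^ 2 - ‖A‖ ^ 2 ≤ -2 * ((B - A) * conj Y).re) :
    m * Y + A ≠ z * (m * Y + B) := by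
  intro h
  have hle : ‖m * Y + B‖ ≤ ‖m * Y + A‖ := by
    rw [← sq_le_sq₀ (norm_nonneg _) (norm_nonneg _), ← sub_nonpos, norm_sq_add_sub_norm_sq_add]
    nlinarith
  have hB : m * Y + B = 0 := by
    rw [h, norm_mul] at hle
    by_contra hB
    exact hle.not_gt (mul_lt_of_lt_one_left (norm_pos_iff.2 hB) hz)
  have hAB : B - A = 0 := by linear_combination (1 - z) * hB - h
  rw [hAB, zero_mul, Complex.zero_re, mul_zero] at h₁
  exact lt_irrefl _ h₁

end ShiftedGauss

theorem mainTheorem1 (a b c : ℂ) (hc : ∀ n : ℕ, c ≠ -(n : ℂ))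
    (Q : ℂ → ℂ) (E : Finset ℂ) (hQ : ShiftedGauss.IsAdmissible Q E)
    (h₁ : ∀ ζ : ℂ, ‖ζ‖ = 1 → ζ ∉ E →
      0 < -2 * (((a + b + 1 - c) * Q ζ + a * b) * conj (ζ * deriv Q ζ)).re)
    (h₂ : ∀ ζ : ℂ, ‖ζ‖ = 1 → ζ ∉ E →
      ‖(Q ζ + a) * (Q ζ + b)‖ ^ 2 - ‖Q ζ * (Q ζ + c - 1)‖ ^ 2 ≤
        -2 * (((a + b + 1 - c) * Q ζ + a * b) * conj (ζ * deriv Q ζ)).re) :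
    (fun z : ℂ => z * ordinaryHypergeometric a b c z) ∈
      ShiftedGauss.starClass (fun z => 1 + Q z) := by
  open ShiftedGauss in
  have hF := analyticOnNhd_ordinaryHypergeometric (a := a) (b := b) hc
  have hF₀ : ordinaryHypergeometric a b c (0 : ℂ) = 1 := ordinaryHypergeometric_zero a b c
  refine mul_mem_starClass hF hF₀ hQ.univalentOn_unitDisk hQ.map_zero <|
    hQ.ne_zero_and_eulerLogDeriv_mem_image hF (hF₀.trans_ne one_ne_zero) ?_
  intro z hz hFz ζ hζ hE hqQ m hm hcontact
  have hz_lt : ‖z‖ < 1 := mem_ball_zero_iff.1 hz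
  have hriccati := eulerLogDeriv_ordinaryHypergeometric_riccati hc hz_lt hFz
  rw [hcontact, hqQ] at hriccati
  have hBA : (Q ζ + a) * (Q ζ + b) - Q ζ * (Q ζ + c - 1) = (a + b + 1 - c) * Q ζ + a * b := by
    ring
  exact mul_add_ne_mul_of_boundary_inequality hm hz_lt (hBA ▸ h₁ ζ hζ hE) (hBA ▸ h₂ ζ hζ hE)
    hriccati
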